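/- Let $\mathcal M=(S,\mathit{Act},P,s_{init},rew,goal)$ be a finite Markov decision process: $S$ and $\mathit{Act}$ are finite sets, $P:S\times \mathit{Act}\times S\to[0,1]$ satisfies $\sum_{t}P(s,\alpha,t)\in\{0,1\}$ for all $(s,\alpha)$ (the action $\alpha$ is enabled in $s$ if the sum is $1$), $s_{init}\in S$ is the initial state, $rew:S\times \mathit{Act}\to\mathbb N$ is the reward function, and $goal\in S$ is a trap state (no action is enabled in it). A scheduler assigns to each finite path that does not end in $goal$ a probability distribution over the actions enabled in its last state; it is memoryless if the choice depends only on the last state, deterministic if all these distributions are Dirac, and reward-based if the choice depends only on the last state $s$ and on the reward $w\in\mathbb N$ accumulated along the path. A scheduler $\mathfrak S$ and a state $s$ induce a probability measure on maximal paths from $s$; write $\mathbb E^{\mathfrak S}_{s}$ for its expectation, $rew$ for the total accumulated reward of a maximal path, $\mathbb E^{\max}_{s}(rew)=\sup_{\mathfrak S}\mathbb E^{\mathfrak S}_{s}(rew)$ (supremum over all schedulers), and drop the index $s$ if $s=s_{init}$. For $\lambda\in\mathbb R$ put $$\mathrm{MADPE}[\lambda]^{\mathfrak S}=\mathbb E^{\mathfrak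 S}(rew)-\lambda\,\mathbb E^{\mathfrak S}\bigl(|rew-\mathbb E^{\mathfrak S}(rew)|\bigr).$$ For reward-based schedulers $\mathfrak S,\mathfrak T$ and $k\in\mathbb N$ let $\mathfrak S\uparrow_k\mathfrak T$ be the reward-based scheduler that chooses like $\mathfrak S(s,w)$ if $w<k$ and like $\mathfrak T(s,w)$ if $w\ge k$. **Theorem.** Assume that $goal$ is reached from $s_{init}$ with probability $1$ under every scheduler. Let $\lambda\in(0,\tfrac12]$, let $\mathfrak T$ be a memoryless deterministic scheduler with $\mathbb E^{\mathfrak T}_{s}(rew)=\mathbb E^{\max}_{s}(rew)$ for all $s\in S$, and let $k=\lceil\mathbb E^{\max}(rew)\rceil$. Then $\mathbb E^{\max}(rew)$ is finite, and for every reward-based scheduler $\mathfrak S$ $$\mathrm{MADPE}[\lambda]^{\mathfrak S}\le \mathrm{MADPE}[\lambda]^{\mathfrak S\uparrow_k\mathfrak T}.$$ Moreover, $\mathfrak S\uparrow_k\mathfrak T$ is eventually reward-maximizing with bound $k$: after every finite path $\pi$ with accumulated reward at least $k$, its expected future reward is $\mathbb E^{\max}_{s}(rew)$ with $s$ the last state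 of $\pi$. Consequently, if a reward-based scheduler $\mathfrak S$ maximizes $\mathrm{MADPE}[\lambda]$ among all schedulers, then so does the eventually reward-maximizing scheduler $\mathfrak S\uparrow_k\mathfrak T$. -/

import Mathlib

open MeasureTheory ProbabilityTheory
open scoped NNReal ENNReal

noncomputable section

/-- A finite Markov decision process with state set `S`, action set `A`, transition probabilities
`P`, initial state, natural-number rewards on state-action pairs, and a trap state `goal`. -/
structure MDP (S A : Type*) [Fintype S] where
  P : S → A → S → ℝ≥0
  sum_P : ∀ s a, ∑ t, P s a t = 0 ∨ ∑ t, P s a t = 1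
  init : S
  rew : S → A → ℕ
  goal : S
  goal_trap : ∀ a, ∑ t, P goal a t = 0

/-- Finite alternating sequences `s₀ a₀ s₁ a₁ … sₙ` of states and actions. -/
inductive FinPath (S A : Type*) where
  | start (s : S) : FinPath S A
  | step (p : FinPath S A) (a : A) (t : S) : FinPath S A

namespace FinPath

variable {S A : Type*}

/-- The last state of a finite sequence. -/
def last : FinPath S A → S
  | start s => s
  | step _ _ t => t

/-- The discrete σ-algebra on finite sequences. -/
instance instMeasurableSpaceFinPath : MeasurableSpace (FinPath S A) := ⊤

end FinPath

namespace MDP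

variable {S A : Type*} [Fintype S] (M : MDP S A)

/-- The actions enabled in the state `s`. -/
def Act (s : S) : Type _ := {a : A // ∑ t, M.P s a t = 1}

/-- The distribution of the successor state when the enabled action `a` is chosen in `s`. -/
def succ (s : S) (a : M.Act s) : PMF S :=
  PMF.ofFintype (fun t => (M.P s a.1 t : ℝ≥0∞)) (by exact_mod_cast a.2)

/-- A finite sequence is a path if all its transitions have positive probability. -/
def IsPath : FinPath S A → Prop
  | .start _ => True
  | .step p a t => IsPath p ∧ 0 < M.P p.last a t

/-- The reward accumulated along a finite sequence. -/
def pathRew : FinPath S A → ℕ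
  | .start _ => 0
  | .step p a _ => pathRew p + M.rew p.last a

/-- A (randomized, history-dependent) scheduler assigns to every history that does not end in
`goal` a probability distribution over the actions enabled in its last state. (Its values on
sequences that are not paths never matter.) -/
def Scheduler : Type _ := (p : FinPath S A) → p.last ≠ M.goal → PMF (M.Act p.last)

/-- A reward-based scheduler: the choice depends only on the current state and on the reward
accumulated so far. -/
def RewardScheduler : Type _ := (s : S) → ℕ → s ≠ M.goal → PMF (M.Act s)

/-- A memoryless deterministic scheduler: an enabled action for each state except `goal`. -/
def MDScheduler : Type _ := (s : S) → s ≠ M.goal → M.Act s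

variable {M}

/-- A reward-based scheduler as a scheduler. -/
def RewardScheduler.toScheduler (𝔖 : M.RewardScheduler) : M.Scheduler :=
  fun p hp => 𝔖 p.last (M.pathRew p) hp

/-- A memoryless deterministic scheduler as a reward-based scheduler. -/
def MDScheduler.toRewardScheduler (𝔗 : M.MDScheduler) : M.RewardScheduler :=
  fun s _ hs => PMF.pure (𝔗 s hs)

/-- `𝔖.switch k 𝔗` follows `𝔖` while the accumulated reward is below `k`, and `𝔗` as soon as it
is at least `k`. -/
def RewardScheduler.switch (𝔖 : M.RewardScheduler) (k : ℕ) (𝔗 : M.RewardScheduler) :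
    M.RewardScheduler :=
  fun s w hs => if w < k then 𝔖 s w hs else 𝔗 s w hs

variable (M)

open Classical in
/-- One step of the process under a scheduler: a history that ends in `goal` is maximal and stays
as it is; any other one is extended by a random action and a random successor state. -/
def next (𝔖 : M.Scheduler) (p : FinPath S A) : PMF (FinPath S A) :=
  if hp : p.last = M.goal then PMF.pure p
  else (𝔖 p hp).bind fun a => (M.succ p.last a).map fun t => p.step a.1 t

/-- `next` as a Markov kernel. -/
def nextKernel (𝔖 : M.Scheduler) : Kernel (FinPath S A) (FinPath S A) where
  toFun p := (M.next 𝔖 p).toMeasure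
  measurable' := measurable_from_top

instance instIsMarkovKernelNextKernel (𝔖 : M.Scheduler) : IsMarkovKernel (M.nextKernel 𝔖) :=
  ⟨fun p => PMF.toMeasure.isProbabilityMeasure (M.next 𝔖 p)⟩

/-- `nextKernel` applied to the most recent entry of a sequence of histories. -/
def stepKernel (𝔖 : M.Scheduler) (n : ℕ) :
    Kernel ((i : Finset.Iic n) → (fun _ : ℕ => FinPath S A) i) (FinPath S A) :=
  (M.nextKernel 𝔖).comap (fun h => h ⟨n, Finset.mem_Iic.2 le_rfl⟩) (measurable_pi_apply _)

instance instIsMarkovKernelStepKernel (𝔖 : M.Scheduler) (n : ℕ) :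
    IsMarkovKernel (M.stepKernel 𝔖 n) := by
  unfold stepKernel; infer_instance

/-- The probability measure on maximal paths induced by the scheduler `𝔖` and the history `p`.
A maximal path `ω` is represented by the sequence of its finite prefixes: `ω n` is the prefix that
consists of `p` and the next `n` steps, and `ω` is eventually constant if `goal` is reached. So the
cylinder set of a finite path extending `p` by `n` steps is the set of all `ω` for which `ω n` is
this path. -/
def pathMeasureFrom (𝔖 : M.Scheduler) (p : FinPath S A) : Measure (ℕ → FinPath S A) :=
  Kernel.traj (X := fun _ => FinPath S A) (M.stepKernel 𝔖) 0 (fun _ => p)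

/-- The probability measure on maximal paths induced by `𝔖` and the starting state `s`. -/
def pathMeasure (𝔖 : M.Scheduler) (s : S) : Measure (ℕ → FinPath S A) :=
  M.pathMeasureFrom 𝔖 (.start s)

/-- The total accumulated reward of a maximal path (rewards are nonnegative, so it is the supremum
of the rewards of the finite prefixes). -/
def totalRew (ω : ℕ → FinPath S A) : ℝ≥0∞ := ⨆ n, (M.pathRew (ω n) : ℝ≥0∞)

/-- The state `goal` is reached from the initial state with probability one, whatever the
scheduler. -/
def ReachesGoal : Prop :=
  ∀ 𝔖 : M.Scheduler, ∀ᵐ ω ∂(M.pathMeasure 𝔖 M.init), ∃ n, (ω n).last = M.goal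

/-- The expected accumulated reward from the state `s` under `𝔖`. -/
def expRew (𝔖 : M.Scheduler) (s : S) : ℝ≥0∞ := ∫⁻ ω, M.totalRew ω ∂(M.pathMeasure 𝔖 s)

/-- The maximal expected accumulated reward from the state `s`. -/
def maxExpRew (s : S) : ℝ≥0∞ := ⨆ 𝔖 : M.Scheduler, M.expRew 𝔖 s

/-- The mean absolute deviation of the accumulated reward from its expected value. -/
def mad (𝔖 : M.Scheduler) : ℝ :=
  ∫ ω, |(M.totalRew ω).toReal - (M.expRew 𝔖 M.init).toReal| ∂(M.pathMeasure 𝔖 M.init)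

/-- The MAD-penalized expectation of the accumulated reward with parameter `lam`. -/
def madpe (lam : ℝ) (𝔖 : M.Scheduler) : ℝ := (M.expRew 𝔖 M.init).toReal - lam * M.mad 𝔖

/-- `𝔖` maximizes the MAD-penalized expectation among all schedulers. -/
def IsMadpeOptimal (lam : ℝ) (𝔖 : M.Scheduler) : Prop :=
  ∀ 𝔖' : M.Scheduler, M.madpe lam 𝔖' ≤ M.madpe lam 𝔖

/-- `𝔖` is reward-maximizing from the bound `B` on: after every finite path whose accumulated
reward is at least `B`, the expected reward still to be collected is the maximal one. -/
def IsRewMaximizingFrom (B : ℕ) (𝔖 : M.Scheduler) : Prop :=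
  ∀ p : FinPath S A, M.IsPath p → B ≤ M.pathRew p →
    ∫⁻ ω, M.totalRew ω ∂(M.pathMeasureFrom 𝔖 p) = M.pathRew p + M.maxExpRew p.last

end MDP

end

noncomputable section

/-! ### Sums against discrete distributions -/

namespace PMF

/-! Write `X` for the total reward and `m` for its mean. Since `|X - m| = 2 (m - X)⁺ + (X - m)` and
the last term has mean zero, the objective is `m - 2 λ E (m - X)⁺`. Every mean is at most `k`, and
for `c ≤ k` a path that has collected `k` contributes nothing to `E (c - X)⁺`; so switching at `k`
leaves this shortfall unchanged (`shortfall_switch`), while it can only raise the mean, from `m` to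
some `m'` (`expRew_le_expRew_switch`). The shortfall is 1-Lipschitz in `c` (`shortfall_le`), so the
objective changes by at least `(1 - 2 λ) (m' - m) ≥ 0`.

Monotonicity of the mean rests on the Bellman inequality for the maximal expected reward. Finiteness
holds because the chain of `𝔗` reaches `goal` almost surely: on the relevant states, the probability
of not having done so halves within a fixed number of steps.

Path integrals are handled as limits of iterates of the one-step operator `nextExp`, by monotone
convergence. -/

theorem lintegral_toMeasure {α : Type*} [MeasurableSpace α] (p : PMF α) {f : α → ℝ≥0∞}
    (hf : Measurable f) : ∫⁻ x, f x ∂p.toMeasure = ∑' x, p x * f x := by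
  have h : p.toMeasure = Measure.sum fun x => p x • Measure.dirac x := by
    ext s hs
    rw [PMF.toMeasure_apply p hs, Measure.sum_apply _ hs]
    refine tsum_congr fun x => ?_
    by_cases hx : x ∈ s <;> simp [hs, hx]
  rw [h, lintegral_sum_measure]
  refine tsum_congr fun x => ?_
  rw [lintegral_smul_measure, lintegral_dirac' _ hf, smul_eq_mul]

theorem tsum_pure_mul {α : Type*} (a : α) (g : α → ℝ≥0∞) :
    ∑' x, PMF.pure a x * g x = g a := by
  classical
  rw [tsum_eq_single a] <;> simp +contextual [PMF.pure_apply]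

theorem tsum_bind_mul {α β : Type*} (p : PMF α) (f : α → PMF β) (g : β → ℝ≥0∞) :
    ∑' y, p.bind f y * g y = ∑' x, p x * ∑' y, f x y * g y := by
  simp_rw [PMF.bind_apply, ← ENNReal.tsum_mul_right, ← ENNReal.tsum_mul_left]
  rw [ENNReal.tsum_comm]
  simp_rw [mul_assoc]

theorem tsum_map_mul {α β : Type*} (p : PMF α) (f : α → β) (g : β → ℝ≥0∞) :
    ∑' y, p.map f y * g y = ∑' x, p x * g (f x) := by
  rw [← PMF.bind_pure_comp, tsum_bind_mul]
  simp_rw [Function.comp_apply, tsum_pure_mul]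

end PMF

/-! ### One-step expectations and the path measure -/

namespace MDP

variable {S A : Type*} [Fintype S] (M : MDP S A)

/-- The expectation of `f` after one further step of the process from a history. -/
def nextExp (𝔖 : M.Scheduler) (f : FinPath S A → ℝ≥0∞) (p : FinPath S A) : ℝ≥0∞ :=
  ∫⁻ q, f q ∂(M.nextKernel 𝔖 p)

theorem nextExp_eq_tsum (𝔖 : M.Scheduler) (f : FinPath S A → ℝ≥0∞) (p : FinPath S A) :
    M.nextExp 𝔖 f p = ∑' q, M.next 𝔖 p q * f q :=
  PMF.lintegral_toMeasure _ measurable_from_top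

variable {M}

theorem nextExp_of_goal (𝔖 : M.Scheduler) (f : FinPath S A → ℝ≥0∞) {p : FinPath S A}
    (hp : p.last = M.goal) : M.nextExp 𝔖 f p = f p := by
  rw [nextExp_eq_tsum, next, dif_pos hp, PMF.tsum_pure_mul]

theorem nextExp_of_ne_goal (𝔖 : M.Scheduler) (f : FinPath S A → ℝ≥0∞) {p : FinPath S A}
    (hp : p.last ≠ M.goal) :
    M.nextExp 𝔖 f p =
      ∑' a, 𝔖 p hp a * ∑ t, (M.P p.last a.1 t : ℝ≥0∞) * f (p.step a.1 t) := by
  rw [nextExp_eq_tsum, next, dif_neg hp, PMF.tsum_bind_mul]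
  refine tsum_congr fun a => ?_
  rw [PMF.tsum_map_mul, tsum_fintype]
  rfl

theorem nextExp_congr_scheduler {𝔖 𝔖' : M.Scheduler} (f : FinPath S A → ℝ≥0∞) {p : FinPath S A}
    (h : ∀ hp, 𝔖 p hp = 𝔖' p hp) : M.nextExp 𝔖 f p = M.nextExp 𝔖' f p := by
  by_cases hp : p.last = M.goal
  · rw [nextExp_of_goal _ _ hp, nextExp_of_goal _ _ hp]
  · rw [nextExp_of_ne_goal _ _ hp, nextExp_of_ne_goal _ _ hp, h]

theorem nextExp_le_nextExp (𝔖 : M.Scheduler) {f g : FinPath S A → ℝ≥0∞} {p : FinPath S A}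
    (hp : f p ≤ g p) (h : ∀ a t, f (p.step a t) ≤ g (p.step a t)) :
    M.nextExp 𝔖 f p ≤ M.nextExp 𝔖 g p := by
  by_cases hp' : p.last = M.goal
  · rwa [nextExp_of_goal _ _ hp', nextExp_of_goal _ _ hp']
  · rw [nextExp_of_ne_goal _ _ hp', nextExp_of_ne_goal _ _ hp']
    gcongr
    exact h _ _

theorem nextExp_congr (𝔖 : M.Scheduler) {f g : FinPath S A → ℝ≥0∞} {p : FinPath S A}
    (hp : f p = g p) (h : ∀ a t, f (p.step a t) = g (p.step a t)) :
    M.nextExp 𝔖 f p = M.nextExp 𝔖 g p :=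
  (nextExp_le_nextExp 𝔖 hp.le fun a t => (h a t).le).antisymm
    (nextExp_le_nextExp 𝔖 hp.ge fun a t => (h a t).ge)

theorem nextExp_mono (𝔖 : M.Scheduler) : Monotone (M.nextExp 𝔖) :=
  fun _ _ h _ => nextExp_le_nextExp 𝔖 (h _) fun _ _ => h _

theorem nextExp_const (𝔖 : M.Scheduler) (c : ℝ≥0∞) (p : FinPath S A) :
    M.nextExp 𝔖 (fun _ => c) p = c := by
  simp [nextExp]

theorem nextExp_iSup (𝔖 : M.Scheduler) {f : ℕ → FinPath S A → ℝ≥0∞} (hf : Monotone f)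
    (p : FinPath S A) :
    M.nextExp 𝔖 (fun q => ⨆ n, f n q) p = ⨆ n, M.nextExp 𝔖 (f n) p :=
  lintegral_iSup (fun _ => measurable_from_top) hf

/-- A function of histories that does not decrease when a history is extended. -/
def StepMono (f : FinPath S A → ℝ≥0∞) : Prop := ∀ p a t, p.last ≠ M.goal → f p ≤ f (p.step a t)

/-- The indicator of a decrease has one-step expectation zero. -/
theorem ae_le_nextKernel (𝔖 : M.Scheduler) {f : FinPath S A → ℝ≥0∞} (hf : M.StepMono f)
    (p : FinPath S A) : ∀ᵐ q ∂(M.nextKernel 𝔖 p), f p ≤ f q := by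
  classical
  have h : M.nextExp 𝔖 (fun q => if f p ≤ f q then 0 else 1) p = 0 := by
    by_cases hp : p.last = M.goal
    · simp [nextExp_of_goal _ _ hp]
    · simp [nextExp_of_ne_goal _ _ hp, hf _ _ _ hp]
  rw [nextExp, lintegral_eq_zero_iff measurable_from_top] at h
  filter_upwards [h] with q hq
  by_contra hc
  simp [hc] at hq

theorem map_pathMeasureFrom_eq_compProd (𝔖 : M.Scheduler) (p : FinPath S A) (n : ℕ) :
    (Kernel.partialTraj (X := fun _ => FinPath S A) (M.stepKernel 𝔖) 0 n (fun _ => p)) ⊗ₘ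
      (M.stepKernel 𝔖 n) =
    (M.pathMeasureFrom 𝔖 p).map fun ω => (Preorder.frestrictLe n ω, ω (n + 1)) :=
  Kernel.partialTraj_compProd_eq_map_traj (zero_le)

instance (𝔖 : M.Scheduler) (p : FinPath S A) : IsProbabilityMeasure (M.pathMeasureFrom 𝔖 p) := by
  unfold pathMeasureFrom; infer_instance

instance (𝔖 : M.Scheduler) (s : S) : IsProbabilityMeasure (M.pathMeasure 𝔖 s) := by
  unfold pathMeasure; infer_instance

omit [Fintype S] in
theorem measurable_pathFun (f : FinPath S A → ℝ≥0∞) (n : ℕ) :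
    Measurable fun ω : ℕ → FinPath S A => f (ω n) :=
  Measurable.comp measurable_from_top (measurable_pi_apply n)

theorem lintegral_path_zero (𝔖 : M.Scheduler) (p : FinPath S A) (f : FinPath S A → ℝ≥0∞) :
    ∫⁻ ω, f (ω 0) ∂(M.pathMeasureFrom 𝔖 p) = f p := by
  have h := Kernel.traj_map_frestrictLe_apply (X := fun _ => FinPath S A)
    (κ := M.stepKernel 𝔖) 0 0 (fun _ => p)
  rw [Kernel.partialTraj_self, Kernel.id_apply] at h
  have hm : Measurable fun x : (i : Finset.Iic 0) → FinPath S A =>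
      f (x ⟨0, Finset.mem_Iic.2 le_rfl⟩) :=
    Measurable.comp measurable_from_top (measurable_pi_apply _)
  calc ∫⁻ ω, f (ω 0) ∂(M.pathMeasureFrom 𝔖 p)
      = ∫⁻ x, f (x ⟨0, Finset.mem_Iic.2 le_rfl⟩)
          ∂((M.pathMeasureFrom 𝔖 p).map (Preorder.frestrictLe 0)) := by
        rw [lintegral_map hm (Preorder.measurable_frestrictLe 0)]; rfl
    _ = f p := by
        rw [pathMeasureFrom, h, lintegral_dirac' _ hm]

theorem lintegral_path_succ (𝔖 : M.Scheduler) (p : FinPath S A) (f : FinPath S A → ℝ≥0∞) (n : ℕ) :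
    ∫⁻ ω, f (ω (n + 1)) ∂(M.pathMeasureFrom 𝔖 p) =
      ∫⁻ ω, M.nextExp 𝔖 f (ω n) ∂(M.pathMeasureFrom 𝔖 p) := by
  have hf : Measurable fun x : ((i : Finset.Iic n) → FinPath S A) × FinPath S A => f x.2 :=
    Measurable.comp measurable_from_top measurable_snd
  have hg : Measurable fun x : (i : Finset.Iic n) → FinPath S A =>
      M.nextExp 𝔖 f (x ⟨n, Finset.mem_Iic.2 le_rfl⟩) :=
    Measurable.comp (g := M.nextExp 𝔖 f) measurable_from_top (measurable_pi_apply _)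
  have hr : Measurable fun ω : ℕ → FinPath S A =>
      (Preorder.frestrictLe (π := fun _ => FinPath S A) n ω, ω (n + 1)) :=
    (Preorder.measurable_frestrictLe n).prodMk (measurable_pi_apply _)
  calc ∫⁻ ω, f (ω (n + 1)) ∂(M.pathMeasureFrom 𝔖 p)
      = ∫⁻ x, f x.2 ∂((M.pathMeasureFrom 𝔖 p).map
          fun ω => (Preorder.frestrictLe (π := fun _ => FinPath S A) n ω, ω (n + 1))) := by
        rw [lintegral_map hf hr]
    _ = ∫⁻ x, M.nextExp 𝔖 f (x ⟨n, Finset.mem_Iic.2 le_rfl⟩)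
          ∂(Kernel.partialTraj (X := fun _ => FinPath S A) (M.stepKernel 𝔖) 0 n (fun _ => p)) := by
        rw [← map_pathMeasureFrom_eq_compProd, Measure.lintegral_compProd hf]
        rfl
    _ = ∫⁻ ω, M.nextExp 𝔖 f (ω n) ∂(M.pathMeasureFrom 𝔖 p) := by
        rw [← Kernel.traj_map_frestrictLe_apply,
          lintegral_map hg (Preorder.measurable_frestrictLe n)]
        rfl

/-- The Markov property, with histories as states: each time step costs one application of the
operator. -/
theorem lintegral_path (𝔖 : M.Scheduler) (p : FinPath S A) (f : FinPath S A → ℝ≥0∞) (n : ℕ) :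
    ∫⁻ ω, f (ω n) ∂(M.pathMeasureFrom 𝔖 p) = (M.nextExp 𝔖)^[n] f p := by
  induction n generalizing f with
  | zero => exact lintegral_path_zero 𝔖 p f
  | succ n ih => rw [lintegral_path_succ, ih, Function.iterate_succ_apply]

theorem ae_monotone_path (𝔖 : M.Scheduler) (p : FinPath S A) {f : FinPath S A → ℝ≥0∞}
    (hf : M.StepMono f) : ∀ᵐ ω ∂(M.pathMeasureFrom 𝔖 p), Monotone fun n => f (ω n) := by
  have hr (n : ℕ) : Measurable fun ω : ℕ → FinPath S A =>
      (Preorder.frestrictLe (π := fun _ => FinPath S A) n ω, ω (n + 1)) :=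
    (Preorder.measurable_frestrictLe n).prodMk (measurable_pi_apply _)
  have hf' : Measurable f := measurable_from_top
  have h (n : ℕ) : ∀ᵐ ω ∂(M.pathMeasureFrom 𝔖 p), f (ω n) ≤ f (ω (n + 1)) := by
    have hs : MeasurableSet {x : ((i : Finset.Iic n) → FinPath S A) × FinPath S A |
        f (x.1 ⟨n, Finset.mem_Iic.2 le_rfl⟩) ≤ f x.2} :=
      measurableSet_le (hf'.comp ((measurable_pi_apply _).comp measurable_fst))
        (hf'.comp measurable_snd)
    have key := (Measure.ae_compProd_iff (μ := Kernel.partialTraj (X := fun _ => FinPath S A)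
      (M.stepKernel 𝔖) 0 n (fun _ => p)) (κ := M.stepKernel 𝔖 n) hs).2
      (Filter.Eventually.of_forall fun x => ae_le_nextKernel 𝔖 hf _)
    rw [map_pathMeasureFrom_eq_compProd] at key
    exact ae_of_ae_map (hr n).aemeasurable key
  filter_upwards [ae_all_iff.2 h] with ω hω using monotone_nat_of_le_succ hω

theorem lintegral_iSup_path (𝔖 : M.Scheduler) (p : FinPath S A) {f : FinPath S A → ℝ≥0∞}
    (hf : M.StepMono f) :
    ∫⁻ ω, ⨆ n, f (ω n) ∂(M.pathMeasureFrom 𝔖 p) = ⨆ n, (M.nextExp 𝔖)^[n] f p := by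
  rw [lintegral_iSup' (fun n => (measurable_pathFun f n).aemeasurable) (ae_monotone_path 𝔖 p hf)]
  simp_rw [lintegral_path]

theorem lintegral_iInf_sub_path (𝔖 : M.Scheduler) (p : FinPath S A) {f : FinPath S A → ℝ≥0∞}
    (hf : M.StepMono f) {c : ℝ≥0∞} (hc : c ≠ ⊤) :
    ∫⁻ ω, ⨅ n, (c - f (ω n)) ∂(M.pathMeasureFrom 𝔖 p) =
      ⨅ n, (M.nextExp 𝔖)^[n] (fun q => c - f q) p := by
  simp_rw [← lintegral_path 𝔖 p (fun q => c - f q)]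
  refine lintegral_iInf' (fun n => (measurable_pathFun (fun q => c - f q) n).aemeasurable) ?_ ?_
  · filter_upwards [ae_monotone_path 𝔖 p hf] with ω hω m n hmn
    exact tsub_le_tsub_left (hω hmn) c
  · refine ((lintegral_mono fun _ => tsub_le_self).trans_lt ?_).ne (b := ⊤)
    simpa using hc.lt_top

end MDP

/-! ### Accumulated reward as a limit of iterates -/

namespace FinPath

variable {S A : Type*}

@[simp]
theorem last_start (s : S) : (start s : FinPath S A).last = s := rfl

@[simp]
theorem last_step (p : FinPath S A) (a : A) (t : S) : (step p a t).last = t := rfl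

end FinPath

namespace MDP

variable {S A : Type*} [Fintype S] {M : MDP S A}

@[simp]
theorem pathRew_start (s : S) : M.pathRew (.start s) = 0 := rfl

@[simp]
theorem pathRew_step (p : FinPath S A) (a : A) (t : S) :
    M.pathRew (p.step a t) = M.pathRew p + M.rew p.last a := rfl

theorem stepMono_pathRew : M.StepMono fun p => (M.pathRew p : ℝ≥0∞) :=
  fun p a t _ => by simp

theorem lintegral_totalRew (𝔖 : M.Scheduler) (p : FinPath S A) :
    ∫⁻ ω, M.totalRew ω ∂(M.pathMeasureFrom 𝔖 p) =
      ⨆ n, (M.nextExp 𝔖)^[n] (fun q => (M.pathRew q : ℝ≥0∞)) p :=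
  lintegral_iSup_path 𝔖 p stepMono_pathRew

theorem expRew_eq_iSup (𝔖 : M.Scheduler) (s : S) :
    M.expRew 𝔖 s = ⨆ n, (M.nextExp 𝔖)^[n] (fun q => (M.pathRew q : ℝ≥0∞)) (.start s) :=
  lintegral_totalRew 𝔖 _

theorem StepMono.le_nextExp (𝔖 : M.Scheduler) {f : FinPath S A → ℝ≥0∞} (hf : M.StepMono f) :
    f ≤ M.nextExp 𝔖 f := fun p => by
  rw [← nextExp_const 𝔖 (f p) p]
  exact lintegral_mono_ae (ae_le_nextKernel 𝔖 hf p)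

theorem StepMono.monotone_iterate (𝔖 : M.Scheduler) {f : FinPath S A → ℝ≥0∞} (hf : M.StepMono f) :
    Monotone fun n => (M.nextExp 𝔖)^[n] f :=
  (nextExp_mono 𝔖).monotone_iterate_of_le_map (hf.le_nextExp 𝔖)

/-- Two schedulers that agree on a set of histories closed under extension lead to the same
expectations from there. -/
theorem iterate_nextExp_congr {𝔖 𝔖' : M.Scheduler} {Q : FinPath S A → Prop}
    (hQ : ∀ p a t, Q p → Q (p.step a t)) (h : ∀ p, Q p → ∀ hp, 𝔖 p hp = 𝔖' p hp)
    (f : FinPath S A → ℝ≥0∞) (n : ℕ) {p : FinPath S A} (hp : Q p) :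
    (M.nextExp 𝔖)^[n] f p = (M.nextExp 𝔖')^[n] f p := by
  induction n generalizing p with
  | zero => rw [Function.iterate_zero, Function.iterate_zero]
  | succ n ih =>
    rw [Function.iterate_succ_apply', Function.iterate_succ_apply',
      nextExp_congr_scheduler _ (h p hp)]
    exact nextExp_congr 𝔖' (ih hp) fun a t => ih (hQ p a t hp)

theorem sum_P_coe {s : S} (a : M.Act s) : ∑ t, (M.P s a.1 t : ℝ≥0∞) = 1 := by
  exact_mod_cast a.2

theorem sum_P_mul_const_add {s : S} (a : M.Act s) (c : ℝ≥0∞) (g : S → ℝ≥0∞) :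
    ∑ t, (M.P s a.1 t : ℝ≥0∞) * (c + g t) = c + ∑ t, (M.P s a.1 t : ℝ≥0∞) * g t := by
  simp_rw [mul_add, Finset.sum_add_distrib, ← Finset.sum_mul, sum_P_coe, one_mul]

/-! ### The Markov chain of a memoryless deterministic scheduler -/

namespace MDScheduler

open Classical in
/-- The expectation of `g` after one step of the Markov chain killed at `goal`. -/
def chainExp (𝔗 : M.MDScheduler) (g : S → ℝ≥0∞) (s : S) : ℝ≥0∞ :=
  if hs : s = M.goal then 0 else ∑ t, (M.P s (𝔗 s hs).1 t : ℝ≥0∞) * g t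

open Classical in
/-- The reward of one step of the Markov chain. -/
def chainRew (𝔗 : M.MDScheduler) (s : S) : ℝ≥0∞ :=
  if hs : s = M.goal then 0 else M.rew s (𝔗 s hs).1

/-- The expected reward of the first `n` steps of the Markov chain. -/
def partialRew (𝔗 : M.MDScheduler) : ℕ → S → ℝ≥0∞
  | 0 => 0
  | n + 1 => 𝔗.chainRew + 𝔗.chainExp (𝔗.partialRew n)

variable (𝔗 : M.MDScheduler)

theorem partialRew_goal (n : ℕ) : 𝔗.partialRew n M.goal = 0 := by
  cases n <;> simp [partialRew, chainRew, chainExp]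

theorem nextExp_of_ne_goal (f : FinPath S A → ℝ≥0∞) {p : FinPath S A} (hp : p.last ≠ M.goal) :
    M.nextExp 𝔗.toRewardScheduler.toScheduler f p =
      ∑ t, (M.P p.last (𝔗 p.last hp).1 t : ℝ≥0∞) * f (p.step (𝔗 p.last hp).1 t) := by
  rw [MDP.nextExp_of_ne_goal _ _ hp]
  exact PMF.tsum_pure_mul (𝔗 p.last hp)
    fun a => ∑ t, (M.P p.last a.1 t : ℝ≥0∞) * f (p.step a.1 t)

/-- The process rests at `goal` while the chain is killed there; the two agree only for functions
vanishing at `goal`. -/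
theorem nextExp_last {g : S → ℝ≥0∞} (hg : g M.goal = 0) (p : FinPath S A) :
    M.nextExp 𝔗.toRewardScheduler.toScheduler (fun q => g q.last) p = 𝔗.chainExp g p.last := by
  by_cases hp : p.last = M.goal
  · rw [nextExp_of_goal _ _ hp, hp, hg, chainExp, dif_pos rfl]
  · rw [nextExp_of_ne_goal _ _ hp, chainExp, dif_neg hp]
    rfl

theorem iterate_nextExp_last {g : S → ℝ≥0∞} (hg : g M.goal = 0) (n : ℕ) (p : FinPath S A) :
    (M.nextExp 𝔗.toRewardScheduler.toScheduler)^[n] (fun q => g q.last) p =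
      𝔗.chainExp^[n] g p.last := by
  induction n generalizing g with
  | zero => rfl
  | succ n ih =>
    rw [Function.iterate_succ_apply, Function.iterate_succ_apply, ← ih (by simp [chainExp]),
      funext (𝔗.nextExp_last hg)]

theorem iterate_nextExp_pathRew (n : ℕ) (p : FinPath S A) :
    (M.nextExp 𝔗.toRewardScheduler.toScheduler)^[n] (fun q => (M.pathRew q : ℝ≥0∞)) p =
      M.pathRew p + 𝔗.partialRew n p.last := by
  induction n generalizing p with
  | zero => simp [partialRew]
  | succ n ih =>
    rw [Function.iterate_succ_apply', funext ih]
    by_cases hp : p.last = M.goal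
    · rw [nextExp_of_goal _ _ hp, hp, partialRew_goal, partialRew_goal]
    · rw [nextExp_of_ne_goal _ _ hp]
      simp only [pathRew_step, FinPath.last_step, Nat.cast_add]
      rw [sum_P_mul_const_add, partialRew, Pi.add_apply, chainRew, chainExp, dif_neg hp,
        dif_neg hp, add_assoc]

theorem expRew_eq_iSup_partialRew (s : S) :
    M.expRew 𝔗.toRewardScheduler.toScheduler s = ⨆ n, 𝔗.partialRew n s := by
  rw [expRew_eq_iSup]
  simp [iterate_nextExp_pathRew]

theorem lintegral_totalRew (p : FinPath S A) :
    ∫⁻ ω, M.totalRew ω ∂(M.pathMeasureFrom 𝔗.toRewardScheduler.toScheduler p) =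
      M.pathRew p + M.expRew 𝔗.toRewardScheduler.toScheduler p.last := by
  rw [MDP.lintegral_totalRew, expRew_eq_iSup_partialRew, ENNReal.add_iSup]
  simp_rw [iterate_nextExp_pathRew]

theorem partialRew_mono : Monotone 𝔗.partialRew := fun m n hmn s => by
  have h := (stepMono_pathRew (M := M)).monotone_iterate 𝔗.toRewardScheduler.toScheduler hmn
    (.start s)
  simpa [iterate_nextExp_pathRew] using h

/-- Choose like `𝔞` in the first step and like `𝔗` afterwards. -/
def firstThen (𝔞 𝔗 : M.MDScheduler) : M.Scheduler
  | .start s, hs => PMF.pure (𝔞 s hs)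
  | .step p a t, hp => 𝔗.toRewardScheduler.toScheduler (.step p a t) hp

/-! ### The Bellman inequality -/

/-- Playing `a` first and `𝔗` afterwards is one of the competitors in the supremum; the left side is
its expected reward over `n + 1` steps. -/
theorem rew_add_sum_partialRew_le (n : ℕ) {s : S} (hs : s ≠ M.goal) (a : M.Act s) :
    M.rew s a.1 + ∑ t, (M.P s a.1 t : ℝ≥0∞) * 𝔗.partialRew n t ≤ M.maxExpRew s := by
  classical
  let 𝔞 : M.MDScheduler := fun s' h => if e : s' = s then e ▸ a else 𝔗 s' h
  have h𝔞 : 𝔞 s hs = a := by simp [𝔞]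
  refine le_trans ?_ (le_iSup (fun 𝔖 => M.expRew 𝔖 s) (firstThen 𝔞 𝔗))
  rw [expRew_eq_iSup]
  refine le_trans (le_of_eq ?_) (le_iSup _ (n + 1))
  have hstep (b : A) (t : S) :
      (M.nextExp (firstThen 𝔞 𝔗))^[n] (fun q => (M.pathRew q : ℝ≥0∞)) (.step (.start s) b t) =
        M.rew s b + 𝔗.partialRew n t := by
    -- Histories of positive length are closed under extension, and on them `firstThen` is `𝔗`.
    rw [iterate_nextExp_congr (𝔖' := 𝔗.toRewardScheduler.toScheduler)
      (Q := fun p => ∃ q b t, p = .step q b t) (fun p b t _ => ⟨p, b, t, rfl⟩)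
      (by rintro _ ⟨q, b, t, rfl⟩ hp; rfl) _ _ ⟨_, _, _, rfl⟩, iterate_nextExp_pathRew]
    simp
  rw [Function.iterate_succ_apply', MDP.nextExp_of_ne_goal _ _ (p := .start s) hs]
  simp_rw [hstep]
  refine Eq.trans ?_ (PMF.tsum_pure_mul (𝔞 s hs) fun b : M.Act s =>
    ∑ t, (M.P s b.1 t : ℝ≥0∞) * (M.rew s b.1 + 𝔗.partialRew n t)).symm
  rw [h𝔞, sum_P_mul_const_add]

/-- Because the single scheduler `𝔗` attains all maxima, they are increasing limits of `partialRew`,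
which pass through the finite sum. -/
theorem rew_add_sum_maxExpRew_le
    (h𝔗 : ∀ s, M.expRew 𝔗.toRewardScheduler.toScheduler s = M.maxExpRew s)
    {s : S} (hs : s ≠ M.goal) (a : M.Act s) :
    M.rew s a.1 + ∑ t, (M.P s a.1 t : ℝ≥0∞) * M.maxExpRew t ≤ M.maxExpRew s := by
  simp_rw [← h𝔗, expRew_eq_iSup_partialRew, ENNReal.mul_iSup]
  rw [ENNReal.finsetSum_iSup_of_monotone (fun t m n hmn => by
    gcongr; exact 𝔗.partialRew_mono hmn t), ENNReal.add_iSup]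
  refine iSup_le fun n => ?_
  rw [← expRew_eq_iSup_partialRew, h𝔗]
  exact 𝔗.rew_add_sum_partialRew_le n hs a

/-- The accumulated reward plus the maximal expected future reward is a supermartingale. -/
theorem nextExp_pathRew_add_maxExpRew_le
    (h𝔗 : ∀ s, M.expRew 𝔗.toRewardScheduler.toScheduler s = M.maxExpRew s)
    (𝔖 : M.Scheduler) (p : FinPath S A) :
    M.nextExp 𝔖 (fun q => M.pathRew q + M.maxExpRew q.last) p ≤
      M.pathRew p + M.maxExpRew p.last := by
  by_cases hp : p.last = M.goal
  · rw [nextExp_of_goal _ _ hp]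
  · rw [MDP.nextExp_of_ne_goal _ _ hp]
    simp only [pathRew_step, FinPath.last_step, Nat.cast_add, sum_P_mul_const_add, add_assoc]
    calc _ ≤ ∑' a, 𝔖 p hp a * (M.pathRew p + M.maxExpRew p.last) := by
          gcongr with a
          exact 𝔗.rew_add_sum_maxExpRew_le h𝔗 hp a
      _ = _ := by rw [ENNReal.tsum_mul_right, PMF.tsum_coe, one_mul]

/-! ### Geometric decay and finiteness -/

theorem chainExp_mono : Monotone 𝔗.chainExp := fun f g h s => by
  unfold chainExp
  split_ifs
  · rfl
  · gcongr; exact h _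

theorem chainExp_add (f g : S → ℝ≥0∞) :
    𝔗.chainExp (f + g) = 𝔗.chainExp f + 𝔗.chainExp g := by
  ext s
  simp only [chainExp, Pi.add_apply]
  split_ifs <;> simp [mul_add, Finset.sum_add_distrib]

theorem partialRew_add (m n : ℕ) :
    𝔗.partialRew (m + n) = 𝔗.partialRew m + 𝔗.chainExp^[m] (𝔗.partialRew n) := by
  induction m with
  | zero => simp [partialRew]
  | succ m ih =>
    rw [Nat.succ_add, partialRew, ih, chainExp_add, partialRew, add_assoc,
      Function.iterate_succ_apply']

open Classical in
/-- The probability that the Markov chain has not reached `goal` within `n` steps. -/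
def survival (n : ℕ) : S → ℝ≥0∞ := 𝔗.chainExp^[n] fun s => if s = M.goal then 0 else 1

theorem survival_succ (n : ℕ) : 𝔗.survival (n + 1) = 𝔗.chainExp (𝔗.survival n) :=
  Function.iterate_succ_apply' _ _ _

theorem survival_antitone : Antitone 𝔗.survival := by
  refine (𝔗.chainExp_mono).antitone_iterate_of_map_le fun s => ?_
  unfold chainExp
  split_ifs with hs
  · rfl
  · calc _ ≤ ∑ t, (M.P s (𝔗 s hs).1 t : ℝ≥0∞) * 1 := by gcongr; dsimp only; split_ifs <;> simp
      _ = 1 := by simp [sum_P_coe]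

/-- The limit is the integral of the infimum of `1 - f (ω n)`, which vanishes as soon as `goal` is
hit. -/
theorem iInf_survival_eq_zero (hM : M.ReachesGoal) : ⨅ n, 𝔗.survival n M.init = 0 := by
  classical
  let f : FinPath S A → ℝ≥0∞ := fun p => if p.last = M.goal then 1 else 0
  have hf : M.StepMono f := fun p a t hp => by simp [f, hp]
  have h := lintegral_iInf_sub_path 𝔗.toRewardScheduler.toScheduler (.start M.init) hf
    ENNReal.one_ne_top
  have hsub : (fun q => 1 - f q) =
      fun q => (fun s => if s = M.goal then (0 : ℝ≥0∞) else 1) q.last := by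
    ext q; by_cases hq : q.last = M.goal <;> simp [f, hq]
  rw [hsub] at h
  simp_rw [iterate_nextExp_last 𝔗 (g := fun s => if s = M.goal then (0 : ℝ≥0∞) else 1)
    (if_pos rfl)] at h
  refine h.symm.trans ?_
  rw [lintegral_eq_zero_of_ae_eq_zero]
  filter_upwards [hM 𝔗.toRewardScheduler.toScheduler] with ω ⟨n, hn⟩
  exact le_antisymm (iInf_le_of_le n (by simp [f, hn])) zero_le

/-- If the survival probability of a state tends to zero, so do those of its successors. -/
theorem iInf_survival_step {s t : S} (hs : s ≠ M.goal) (h : ⨅ n, 𝔗.survival n s = 0)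
    (ht : M.P s (𝔗 s hs).1 t ≠ 0) : ⨅ n, 𝔗.survival n t = 0 := by
  have hle : (M.P s (𝔗 s hs).1 t : ℝ≥0∞) * ⨅ n, 𝔗.survival n t ≤ ⨅ n, 𝔗.survival n s := by
    refine le_iInf fun n => le_trans ?_ (𝔗.survival_antitone n.le_succ s)
    rw [survival_succ, chainExp, dif_neg hs]
    exact le_trans (mul_le_mul_right (iInf_le _ n) _)
      (Finset.single_le_sum (f := fun t => (M.P s (𝔗 s hs).1 t : ℝ≥0∞) * 𝔗.survival n t)
        (fun _ _ => zero_le) (Finset.mem_univ t))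
  rw [h, nonpos_iff_eq_zero, mul_eq_zero] at hle
  exact hle.resolve_left (by exact_mod_cast ht)

/-- Vanishing limit survival stands in for reachability from the initial state: it passes to
successors, so the bound on `g` is needed only there. -/
theorem iterate_chainExp_le {g : S → ℝ≥0∞} (hg : g M.goal = 0) {c : ℝ≥0∞}
    (hc : ∀ s, ⨅ n, 𝔗.survival n s = 0 → g s ≤ c) (m : ℕ) {s : S}
    (hs : ⨅ n, 𝔗.survival n s = 0) : 𝔗.chainExp^[m] g s ≤ c * 𝔗.survival m s := by
  induction m generalizing s with
  | zero =>
    by_cases h : s = M.goal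
    · simp [h, hg]
    · simpa [survival, h] using hc s hs
  | succ m ih =>
    rw [Function.iterate_succ_apply', survival_succ]
    by_cases h : s = M.goal
    · simp [chainExp, h]
    · rw [chainExp, chainExp, dif_neg h, dif_neg h, Finset.mul_sum]
      refine Finset.sum_le_sum fun t _ => ?_
      by_cases ht : M.P s (𝔗 s h).1 t = 0
      · simp [ht]
      · rw [mul_left_comm]
        gcongr
        exact ih (𝔗.iInf_survival_step h hs ht)

theorem exists_survival_le_half :
    ∃ N, ∀ s, ⨅ n, 𝔗.survival n s = 0 → 𝔗.survival (N + 1) s ≤ 2⁻¹ := by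
  have h (s : S) : ∃ N, ⨅ n, 𝔗.survival n s = 0 → 𝔗.survival N s ≤ 2⁻¹ := by
    by_cases hs : ⨅ n, 𝔗.survival n s = 0
    · obtain ⟨N, hN⟩ := iInf_lt_iff.1 (hs.trans_lt (by simp : (0 : ℝ≥0∞) < 2⁻¹))
      exact ⟨N, fun _ => hN.le⟩
    · exact ⟨0, fun h => absurd h hs⟩
  choose N hN using h
  refine ⟨Finset.univ.sup N, fun s hs => (𝔗.survival_antitone ?_ s).trans (hN s hs)⟩
  exact (Finset.le_sup (Finset.mem_univ s)).trans (Nat.le_succ _)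

theorem partialRew_ne_top (n : ℕ) (s : S) : 𝔗.partialRew n s ≠ ⊤ := by
  induction n generalizing s with
  | zero => simp [partialRew]
  | succ n ih =>
    by_cases hs : s = M.goal
    · simp [partialRew, chainRew, chainExp, hs]
    · simp [partialRew, chainRew, chainExp, hs, ENNReal.mul_eq_top, ih]

theorem exists_partialRew_le :
    ∃ B : ℝ≥0∞, B ≠ ⊤ ∧ ∀ n s, ⨅ m, 𝔗.survival m s = 0 → 𝔗.partialRew n s ≤ B := by
  obtain ⟨N, hN⟩ := 𝔗.exists_survival_le_half
  set c : ℝ≥0∞ := ∑ s, 𝔗.partialRew (N + 1) s with hc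
  have hle (s : S) : 𝔗.partialRew (N + 1) s ≤ c :=
    Finset.single_le_sum (f := 𝔗.partialRew (N + 1)) (fun _ _ => zero_le) (Finset.mem_univ s)
  -- `B = 2 c` solves `c + B / 2 = B`: a block of `N + 1` steps earns at most `c`, and at most half
  -- the mass survives it.
  refine ⟨c * 2, ENNReal.mul_ne_top (by simp [hc, partialRew_ne_top]) (by simp), fun n => ?_⟩
  induction n with
  | zero => simp [partialRew]
  | succ n ih =>
    intro s hs
    -- The block has at least one step, so the induction advances even if `N = 0`.
    calc 𝔗.partialRew (n + 1) s ≤ 𝔗.partialRew (N + 1 + n) s := 𝔗.partialRew_mono (by lia) s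
      _ = 𝔗.partialRew (N + 1) s + 𝔗.chainExp^[N + 1] (𝔗.partialRew n) s := by
        rw [partialRew_add]; rfl
      _ ≤ c + c * 2 * 2⁻¹ := by
        gcongr
        · exact hle s
        · refine (𝔗.iterate_chainExp_le (𝔗.partialRew_goal n) ih (N + 1) hs).trans ?_
          gcongr
          exact hN s hs
      _ = c * 2 := by
        rw [mul_assoc, ENNReal.mul_inv_cancel (by simp) (by simp), mul_one, mul_two]

theorem expRew_init_ne_top (hM : M.ReachesGoal) :
    M.expRew 𝔗.toRewardScheduler.toScheduler M.init ≠ ⊤ := by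
  obtain ⟨B, hB, h⟩ := 𝔗.exists_partialRew_le
  rw [expRew_eq_iSup_partialRew]
  exact ((iSup_le fun n => h n _ (𝔗.iInf_survival_eq_zero hM)).trans_lt hB.lt_top).ne

end MDScheduler

end MDP

/-! ### Switching at the reward bound -/

namespace MDP

variable {S A : Type*} [Fintype S] {M : MDP S A}

section Switch

variable (𝔖 : M.RewardScheduler) (k : ℕ) (𝔗 : M.MDScheduler)

theorem iterate_nextExp_switch (f : FinPath S A → ℝ≥0∞) (n : ℕ) {p : FinPath S A}
    (hp : k ≤ M.pathRew p) :
    (M.nextExp (𝔖.switch k 𝔗.toRewardScheduler).toScheduler)^[n] f p =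
      (M.nextExp 𝔗.toRewardScheduler.toScheduler)^[n] f p :=
  iterate_nextExp_congr (Q := fun p => k ≤ M.pathRew p)
    (fun _ _ _ h => h.trans (Nat.le_add_right _ _))
    (fun _ h _ => if_neg (not_lt.2 h)) f n hp

theorem lintegral_totalRew_switch {p : FinPath S A} (hp : k ≤ M.pathRew p) :
    ∫⁻ ω, M.totalRew ω
        ∂(M.pathMeasureFrom (𝔖.switch k 𝔗.toRewardScheduler).toScheduler p) =
      M.pathRew p + M.expRew 𝔗.toRewardScheduler.toScheduler p.last := by
  rw [← 𝔗.lintegral_totalRew, lintegral_totalRew, lintegral_totalRew]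
  simp_rw [iterate_nextExp_switch 𝔖 k 𝔗 _ _ hp]

theorem nextExp_switch_of_lt (𝔗 : M.RewardScheduler) (f : FinPath S A → ℝ≥0∞) {p : FinPath S A}
    (hp : M.pathRew p < k) :
    M.nextExp (𝔖.switch k 𝔗).toScheduler f p = M.nextExp 𝔖.toScheduler f p :=
  nextExp_congr_scheduler f fun _ => if_pos hp

/-- The value `U` of the switched scheduler dominates the accumulated reward and is superharmonic
for `𝔖`, hence bounds all iterates for `𝔖`. -/
theorem expRew_le_expRew_switch
    (h𝔗 : ∀ s, M.expRew 𝔗.toRewardScheduler.toScheduler s = M.maxExpRew s) (s : S) :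
    M.expRew 𝔖.toScheduler s ≤ M.expRew (𝔖.switch k 𝔗.toRewardScheduler).toScheduler s := by
  let 𝔖' := (𝔖.switch k 𝔗.toRewardScheduler).toScheduler
  let U : FinPath S A → ℝ≥0∞ := fun p => ∫⁻ ω, M.totalRew ω ∂(M.pathMeasureFrom 𝔖' p)
  have hU : U = fun p => ⨆ n, (M.nextExp 𝔖')^[n] (fun q => (M.pathRew q : ℝ≥0∞)) p :=
    funext fun p => lintegral_totalRew 𝔖' p
  have hmono := (stepMono_pathRew (M := M)).monotone_iterate 𝔖'
  have hfix (p : FinPath S A) : M.nextExp 𝔖' U p ≤ U p := by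
    rw [hU, nextExp_iSup 𝔖' hmono]
    refine iSup_le fun n => ?_
    rw [← Function.iterate_succ_apply' (M.nextExp 𝔖')]
    exact le_iSup (fun n => (M.nextExp 𝔖')^[n] (fun q => (M.pathRew q : ℝ≥0∞)) p) (n + 1)
  -- Below `k` both schedulers take the same step; from `k` on, `U` is the reward so far plus the
  -- maximal future reward, so the Bellman inequality applies.
  have hsuper : M.nextExp 𝔖.toScheduler U ≤ U := fun p => by
    rcases lt_or_ge (M.pathRew p) k with hp | hp
    · rw [← nextExp_switch_of_lt 𝔖 k 𝔗.toRewardScheduler U hp]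
      exact hfix p
    · have hval {q : FinPath S A} (hq : k ≤ M.pathRew q) :
          U q = M.pathRew q + M.maxExpRew q.last := by
        rw [← h𝔗]; exact lintegral_totalRew_switch 𝔖 k 𝔗 hq
      rw [nextExp_congr _ (g := fun q => M.pathRew q + M.maxExpRew q.last) (hval hp)
        fun a t => hval (hp.trans (Nat.le_add_right _ _)), hval hp]
      exact 𝔗.nextExp_pathRew_add_maxExpRew_le h𝔗 _ p
  have hle : (fun q => (M.pathRew q : ℝ≥0∞)) ≤ U := by
    rw [hU]
    exact fun p => le_iSup (fun n => (M.nextExp 𝔖')^[n] (fun q => (M.pathRew q : ℝ≥0∞)) p) 0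
  rw [expRew_eq_iSup]
  refine iSup_le fun n => ?_
  exact ((nextExp_mono _).iterate n hle _).trans
    ((nextExp_mono _).antitone_iterate_of_map_le hsuper (zero_le (a := n)) _)

/-- The expected shortfall of the accumulated reward with respect to `c`. -/
def shortfall (𝔖 : M.Scheduler) (c : ℝ≥0∞) : ℝ≥0∞ :=
  ∫⁻ ω, (c - M.totalRew ω) ∂(M.pathMeasure 𝔖 M.init)

theorem shortfall_eq_iInf (𝔖 : M.Scheduler) {c : ℝ≥0∞} (hc : c ≠ ⊤) :
    shortfall 𝔖 c =
      ⨅ n, (M.nextExp 𝔖)^[n] (fun q => c - (M.pathRew q : ℝ≥0∞)) (.start M.init) := by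
  simp_rw [shortfall, totalRew, ENNReal.sub_iSup hc]
  exact lintegral_iInf_sub_path 𝔖 _ stepMono_pathRew hc

/-- The schedulers differ only after histories with reward at least `k ≥ c`, where the shortfall is
already zero and stays so under any scheduler. -/
theorem shortfall_switch (𝔗 : M.RewardScheduler) {c : ℝ≥0∞} (hc : c ≤ k) :
    shortfall (𝔖.switch k 𝔗).toScheduler c = shortfall 𝔖.toScheduler c := by
  have hc' : c ≠ ⊤ := (hc.trans_lt (ENNReal.natCast_lt_top k)).ne
  let f : FinPath S A → ℝ≥0∞ := fun q => c - (M.pathRew q : ℝ≥0∞)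
  have hzero {p : FinPath S A} (hp : k ≤ M.pathRew p) : f p = 0 :=
    tsub_eq_zero_of_le (hc.trans (by exact_mod_cast hp))
  have hext {p : FinPath S A} (hp : k ≤ M.pathRew p) (a : A) (t : S) :
      k ≤ M.pathRew (p.step a t) := hp.trans (Nat.le_add_right _ _)
  have hiter (𝔖 : M.Scheduler) (n : ℕ) {p : FinPath S A} (hp : k ≤ M.pathRew p) :
      (M.nextExp 𝔖)^[n] f p = 0 := by
    induction n generalizing p with
    | zero => exact hzero hp
    | succ n ih =>
      rw [Function.iterate_succ_apply', nextExp_congr 𝔖 (g := fun _ => 0) (ih hp)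
        fun a t => ih (hext hp a t), nextExp_const]
  have key (n : ℕ) : (M.nextExp (𝔖.switch k 𝔗).toScheduler)^[n] f =
      (M.nextExp 𝔖.toScheduler)^[n] f := by
    induction n with
    | zero => rw [Function.iterate_zero, Function.iterate_zero]
    | succ n ih =>
      ext p
      rcases lt_or_ge (M.pathRew p) k with hp | hp
      · rw [Function.iterate_succ_apply', Function.iterate_succ_apply', ih,
          nextExp_switch_of_lt _ _ _ _ hp]
      · rw [hiter _ _ hp, hiter _ _ hp]
  rw [shortfall_eq_iInf _ hc', shortfall_eq_iInf _ hc']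
  exact iInf_congr fun n => congrFun (key n) _

end Switch

/-! ### Mean absolute deviation as twice the shortfall -/

theorem measurable_totalRew : Measurable (M.totalRew) :=
  Measurable.iSup fun n => measurable_pathFun (fun p => (M.pathRew p : ℝ≥0∞)) n

theorem shortfall_le (𝔖 : M.Scheduler) (c d : ℝ≥0∞) :
    shortfall 𝔖 d ≤ shortfall 𝔖 c + (d - c) := by
  calc shortfall 𝔖 d
      ≤ ∫⁻ ω, ((c - M.totalRew ω) + (d - c)) ∂(M.pathMeasure 𝔖 M.init) := by
        refine lintegral_mono fun ω => ?_
        rw [add_comm]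
        exact tsub_le_tsub_add_tsub
    _ = shortfall 𝔖 c + (d - c) := by
        rw [lintegral_add_right _ measurable_const, lintegral_const, measure_univ, mul_one]
        rfl

theorem shortfall_ne_top (𝔖 : M.Scheduler) {c : ℝ≥0∞} (hc : c ≠ ⊤) : shortfall 𝔖 c ≠ ⊤ := by
  refine ((lintegral_mono fun _ => tsub_le_self).trans_lt ?_).ne (b := ⊤)
  simpa using hc.lt_top

/-- Deviations above and below the mean balance, so the lower ones count twice. -/
theorem mad_eq (𝔖 : M.Scheduler) (h : M.expRew 𝔖 M.init ≠ ⊤) :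
    M.mad 𝔖 = 2 * (shortfall 𝔖 (M.expRew 𝔖 M.init)).toReal := by
  set m := M.expRew 𝔖 M.init
  have hsub : Measurable fun ω => m - M.totalRew ω := measurable_const.sub measurable_totalRew
  have hX := integrable_toReal_of_lintegral_ne_top measurable_totalRew.aemeasurable h
  have hY := integrable_toReal_of_lintegral_ne_top hsub.aemeasurable (shortfall_ne_top 𝔖 h)
  have hfin := ae_lt_top measurable_totalRew h
  have hXint : ∫ ω, (M.totalRew ω).toReal ∂(M.pathMeasure 𝔖 M.init) = m.toReal :=
    integral_toReal measurable_totalRew.aemeasurable hfin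
  have hYint : ∫ ω, (m - M.totalRew ω).toReal ∂(M.pathMeasure 𝔖 M.init) =
      (shortfall 𝔖 m).toReal :=
    integral_toReal hsub.aemeasurable (ae_of_all _ fun _ => tsub_le_self.trans_lt h.lt_top)
  have hae : (fun ω => |(M.totalRew ω).toReal - m.toReal|) =ᵐ[M.pathMeasure 𝔖 M.init]
      fun ω => 2 * (m - M.totalRew ω).toReal + ((M.totalRew ω).toReal - m.toReal) := by
    filter_upwards [hfin] with ω hω
    rcases le_total m (M.totalRew ω) with hle | hle
    · rw [tsub_eq_zero_of_le hle,
        abs_of_nonneg (sub_nonneg.2 ((ENNReal.toReal_le_toReal h hω.ne).2 hle))]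
      simp
    · rw [ENNReal.toReal_sub_of_le hle h,
        abs_of_nonpos (sub_nonpos.2 ((ENNReal.toReal_le_toReal hω.ne h).2 hle))]
      ring
  have hXm : Integrable (fun ω => (M.totalRew ω).toReal - m.toReal) (M.pathMeasure 𝔖 M.init) :=
    hX.sub (integrable_const _)
  rw [mad, integral_congr_ae hae, integral_add (hY.const_mul 2) hXm,
    integral_const_mul, integral_sub hX (integrable_const _), hXint, hYint]
  simp

end MDP

end

/-! ### The main theorem -/

theorem mainTheorem1 {S A : Type*} [Fintype S] [Fintype A] (M : MDP S A) (hM : M.ReachesGoal)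
    (lam : ℝ) (hlam0 : 0 < lam) (hlam : lam ≤ 1 / 2)
    (𝔗 : M.MDScheduler)
    (h𝔗 : ∀ s, M.expRew 𝔗.toRewardScheduler.toScheduler s = M.maxExpRew s)
    (k : ℕ) (hk : k = ⌈(M.maxExpRew M.init).toReal⌉₊) :
    M.maxExpRew M.init ≠ ⊤ ∧
    (∀ 𝔖 : M.RewardScheduler,
      M.madpe lam 𝔖.toScheduler ≤ M.madpe lam (𝔖.switch k 𝔗.toRewardScheduler).toScheduler) ∧
    (∀ 𝔖 : M.RewardScheduler,
      M.IsRewMaximizingFrom k (𝔖.switch k 𝔗.toRewardScheduler).toScheduler ∧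
      (M.IsMadpeOptimal lam 𝔖.toScheduler →
        M.IsMadpeOptimal lam (𝔖.switch k 𝔗.toRewardScheduler).toScheduler)) := by
  have hfin : M.maxExpRew M.init ≠ ⊤ := h𝔗 M.init ▸ 𝔗.expRew_init_ne_top hM
  have hle (𝔖 : M.Scheduler) : M.expRew 𝔖 M.init ≤ M.maxExpRew M.init :=
    le_iSup (fun 𝔖 => M.expRew 𝔖 M.init) 𝔖
  have hmax : M.maxExpRew M.init ≤ k := by
    rw [← ENNReal.ofReal_toReal hfin, ← ENNReal.ofReal_natCast, hk]
    exact ENNReal.ofReal_le_ofReal (Nat.le_ceil _)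
  have hmadpe (𝔖 : M.RewardScheduler) :
      M.madpe lam 𝔖.toScheduler ≤ M.madpe lam (𝔖.switch k 𝔗.toRewardScheduler).toScheduler := by
    have hmono := MDP.expRew_le_expRew_switch 𝔖 k 𝔗 h𝔗 M.init
    have hm := ne_top_of_le_ne_top hfin (hle 𝔖.toScheduler)
    have hm' := ne_top_of_le_ne_top hfin (hle (𝔖.switch k 𝔗.toRewardScheduler).toScheduler)
    -- The target is the mean of the switched scheduler for both shortfalls; moving it to the mean
    -- of `𝔖` is left to the Lipschitz bound.
    have hshort := MDP.shortfall_switch 𝔖 k 𝔗.toRewardScheduler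
      ((hle (𝔖.switch k 𝔗.toRewardScheduler).toScheduler).trans hmax)
    rw [MDP.madpe, MDP.madpe, MDP.mad_eq _ hm, MDP.mad_eq _ hm', hshort]
    generalize M.expRew (𝔖.switch k 𝔗.toRewardScheduler).toScheduler M.init = m' at *
    generalize M.expRew 𝔖.toScheduler M.init = m at *
    have hs := MDP.shortfall_ne_top 𝔖.toScheduler hm
    have h := ENNReal.toReal_mono (ENNReal.add_ne_top.2 ⟨hs, ENNReal.sub_ne_top hm'⟩)
      (MDP.shortfall_le 𝔖.toScheduler m m')
    rw [ENNReal.toReal_add hs (ENNReal.sub_ne_top hm'), ENNReal.toReal_sub_of_le hmono hm'] at h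
    have hmm := ENNReal.toReal_mono hm' hmono
    -- The Lipschitz bound costs at most `2 λ (m' - m)`, which the gain `m' - m` covers exactly
    -- because `λ ≤ 1/2`.
    nlinarith [mul_le_mul_of_nonneg_left h hlam0.le,
      mul_nonneg (sub_nonneg.2 hlam) (sub_nonneg.2 hmm)]
  refine ⟨hfin, hmadpe, fun 𝔖 => ⟨fun p _ hp => ?_, fun hopt 𝔖' => (hopt 𝔖').trans (hmadpe 𝔖)⟩⟩
  rw [MDP.lintegral_totalRew_switch 𝔖 k 𝔗 hp, h𝔗]
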